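/- Let $\Phi_k\in\mathbb R^{n\times n}$, $H_k\in\mathbb R^{m\times n}$ ($k=0,1,2,\dots$) be matrices, let $Q_k\in\mathbb R^{n\times n}$ and $R_k\in\mathbb R^{m\times m}$ be symmetric positive definite, let $\hat x_0\in\mathbb R^n$ and let $P_0\in\mathbb R^{n\times n}$ be symmetric positive semidefinite. Consider on a probability space the linear-Gaussian model $$x_{k+1}=\Phi_kx_k+u_k,\qquad z_k=H_kx_k+w_k,\qquad k=0,1,2,\dots,$$ where $x_0\sim\mathcal N(\hat x_0,P_0)$, $u_k\sim\mathcal N(0,Q_k)$, $w_k\sim\mathcal N(0,R_k)$, and the random vectors $x_0,u_0,u_1,\dots,w_0,w_1,\dots$ are mutually independent. Write $Z_k=(z_0,\dots,z_k)$, with $Z_{-1}$ empty. Let $\hat x_{k|k-1}$ and $P_{k|k-1}$ be the mean and covariance matrix of the (regular) conditional distribution of $x_k$ given $Z_{k-1}$ (the predictive distribution), and $\hat x_{k|k}$ and $P_{k|k}$ those of the conditional distribution of $x_k$ given $Z_k$ (the posterior distribution). Then almost surely $\hat x_{0|-1}=\hat x_0$, $P_{0|-1}=P_0$, and for every $k\ge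 0$ the following hold. 1. The predictive distribution of $x_k$ given $Z_{k-1}$ is $\mathcal N(\hat x_{k|k-1},P_{k|k-1})$ and the posterior distribution of $x_k$ given $Z_k$ is $\mathcal N(\hat x_{k|k},P_{k|k})$. If $k\ge1$ or $P_0$ is positive definite, then $P_{k|k-1}$ and $P_{k|k}$ are positive definite and these distributions have the Gaussian densities $p(x_k|Z_{k-1})=\mathcal G(x_k,\hat x_{k|k-1},P_{k|k-1})$ and $p(x_k|Z_k)=\mathcal G(x_k,\hat x_{k|k},P_{k|k})$, where $\mathcal G(x,a,S)=\det(2\pi S)^{-1/2}\exp\left(-\tfrac12(x-a)^TS^{-1}(x-a)\right)$. 2. (Predictor) $\hat x_{k+1|k}=\Phi_k\hat x_{k|k}$ and $P_{k+1|k}=\Phi_kP_{k|k}\Phi_k^T+Q_k$. 3. (Update) With the Kalman gain $K_k=P_{k|k-1}H_k^T(R_k+H_kP_{k|k-1}H_k^T)^{-1}$, $$\hat x_{k|k}=\hat x_{k|k-1}+K_k(z_k-H_k\hat x_{k|k-1}),\qquad P_{k|k}=(I-K_kH_k)P_{k|k-1}.$$ 4. (One-step form) Consequently $$\hat x_{k+1|k}=\Phi_k\hat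 x_{k|k-1}+\Phi_kP_{k|k-1}H_k^T\left[H_kP_{k|k-1}H_k^T+R_k\right]^{-1}(z_k-H_k\hat x_{k|k-1}),$$ $$P_{k+1|k}=\Phi_kP_{k|k-1}\left\{I-H_k^T\left[H_kP_{k|k-1}H_k^T+R_k\right]^{-1}H_kP_{k|k-1}\right\}\Phi_k^T+Q_k.$$ -/

import Mathlib

open MeasureTheory ProbabilityTheory Matrix

noncomputable section

/-- The sources of randomness of the model: the initial state, the process noises `u k`
and the measurement noises `w k`. -/
inductive NoiseSource : Type
  | init : NoiseSource
  | process (k : ℕ) : NoiseSource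
  | measurement (k : ℕ) : NoiseSource

/-- Dimension of each source: the state dimension `n` or the measurement dimension `m`. -/
def NoiseSource.dim (n m : ℕ) : NoiseSource → ℕ
  | .init => n
  | .process _ => n
  | .measurement _ => m

/-- The family consisting of `x₀`, all `u k` and all `w k`. -/
def noiseFamily {Ω : Type*} {n m : ℕ}
    (x₀ : Ω → EuclideanSpace ℝ (Fin n))
    (u : ℕ → Ω → EuclideanSpace ℝ (Fin n))
    (w : ℕ → Ω → EuclideanSpace ℝ (Fin m)) :
    (i : NoiseSource) → Ω → EuclideanSpace ℝ (Fin (NoiseSource.dim n m i))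
  | .init => x₀
  | .process k => u k
  | .measurement k => w k

/-- The linear-Gaussian state space model
`x (k+1) = Φ k * x k + u k`, `z k = H k * x k + w k`, where `x 0 ∼ N(xhat₀, P₀)`,
`u k ∼ N(0, Q k)`, `w k ∼ N(0, R k)` are mutually independent, and all `Q k`, `R k` are
positive definite. -/
structure IsLinearGaussianModel {Ω : Type*} [MeasurableSpace Ω] (μ : Measure Ω) {n m : ℕ}
    (Φ Q : ℕ → Matrix (Fin n) (Fin n) ℝ)
    (H : ℕ → Matrix (Fin m) (Fin n) ℝ) (R : ℕ → Matrix (Fin m) (Fin m) ℝ)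
    (xhat₀ : EuclideanSpace ℝ (Fin n)) (P₀ : Matrix (Fin n) (Fin n) ℝ)
    (x u : ℕ → Ω → EuclideanSpace ℝ (Fin n))
    (z w : ℕ → Ω → EuclideanSpace ℝ (Fin m)) : Prop where
  posDef_Q : ∀ k, (Q k).PosDef
  posDef_R : ∀ k, (R k).PosDef
  posSemidef_P₀ : P₀.PosSemidef
  measurable_init : Measurable (x 0)
  measurable_u : ∀ k, Measurable (u k)
  measurable_w : ∀ k, Measurable (w k)
  law_init : μ.map (x 0) = multivariateGaussian xhat₀ P₀
  law_u : ∀ k, μ.map (u k) = multivariateGaussian 0 (Q k)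
  law_w : ∀ k, μ.map (w k) = multivariateGaussian 0 (R k)
  indep : iIndepFun (noiseFamily (x 0) u w) μ
  state_eq : ∀ k ω, x (k + 1) ω = toEuclideanLin (Φ k) (x k ω) + u k ω
  measurement_eq : ∀ k ω, z k ω = toEuclideanLin (H k) (x k ω) + w k ω

/-- The first `j` measurements `(z 0, …, z (j-1))`. -/
def firstMeasurements {Ω : Type*} {m : ℕ} (z : ℕ → Ω → EuclideanSpace ℝ (Fin m)) (j : ℕ)
    (ω : Ω) : Fin j → EuclideanSpace ℝ (Fin m) :=
  fun i => z i ω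

/-- The conditional distribution of the state `x k` given the first `j` measurements,
evaluated at the observed measurements. -/
def stateCondLaw {Ω : Type*} [MeasurableSpace Ω] (μ : Measure Ω) [IsFiniteMeasure μ] {n m : ℕ}
    (x : ℕ → Ω → EuclideanSpace ℝ (Fin n)) (z : ℕ → Ω → EuclideanSpace ℝ (Fin m))
    (k j : ℕ) (ω : Ω) : Measure (EuclideanSpace ℝ (Fin n)) :=
  condDistrib (x k) (firstMeasurements z j) μ (firstMeasurements z j ω)

/-- Predictive law `p(x_k | z_0, …, z_{k-1})`; for `k = 0` there are no measurements. -/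
def predictiveLaw {Ω : Type*} [MeasurableSpace Ω] (μ : Measure Ω) [IsFiniteMeasure μ] {n m : ℕ}
    (x : ℕ → Ω → EuclideanSpace ℝ (Fin n)) (z : ℕ → Ω → EuclideanSpace ℝ (Fin m))
    (k : ℕ) (ω : Ω) : Measure (EuclideanSpace ℝ (Fin n)) :=
  stateCondLaw μ x z k k ω

/-- Posterior law `p(x_k | z_0, …, z_k)`. -/
def posteriorLaw {Ω : Type*} [MeasurableSpace Ω] (μ : Measure Ω) [IsFiniteMeasure μ] {n m : ℕ}
    (x : ℕ → Ω → EuclideanSpace ℝ (Fin n)) (z : ℕ → Ω → EuclideanSpace ℝ (Fin m))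
    (k : ℕ) (ω : Ω) : Measure (EuclideanSpace ℝ (Fin n)) :=
  stateCondLaw μ x z k (k + 1) ω

/-- Mean vector of a law on `ℝⁿ`. -/
def meanVec {n : ℕ} (μ : Measure (EuclideanSpace ℝ (Fin n))) : EuclideanSpace ℝ (Fin n) :=
  ∫ v, v ∂μ

/-- Covariance matrix of a law on `ℝⁿ`. -/
def covMat {n : ℕ} (μ : Measure (EuclideanSpace ℝ (Fin n))) : Matrix (Fin n) (Fin n) ℝ :=
  Matrix.of fun i j => cov[fun v => v i, fun v => v j; μ]

/-- The Gaussian density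
`G(v, a, S) = det(2πS)^(-1/2) * exp(-(1/2) (v - a)ᵀ S⁻¹ (v - a))`. -/
def gaussianDensity {n : ℕ} (a : EuclideanSpace ℝ (Fin n)) (S : Matrix (Fin n) (Fin n) ℝ)
    (v : EuclideanSpace ℝ (Fin n)) : ℝ :=
  (Real.sqrt ((2 * Real.pi) • S).det)⁻¹ *
    Real.exp (-(1 / 2) * ((v - a).ofLp ⬝ᵥ (S⁻¹ *ᵥ (v - a).ofLp)))

/-- The law `μ` has the (nondegenerate) Gaussian density with mean `a` and covariance `S`. -/
def HasGaussianDensity {n : ℕ} (μ : Measure (EuclideanSpace ℝ (Fin n)))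
    (a : EuclideanSpace ℝ (Fin n)) (S : Matrix (Fin n) (Fin n) ℝ) : Prop :=
  S.PosDef ∧ μ = volume.withDensity (fun v => ENNReal.ofReal (gaussianDensity a S v))

/-- The Kalman gain `P Hᵀ (R + H P Hᵀ)⁻¹`. -/
def kalmanGain {n m : ℕ} (H : Matrix (Fin m) (Fin n) ℝ) (R : Matrix (Fin m) (Fin m) ℝ)
    (P : Matrix (Fin n) (Fin n) ℝ) : Matrix (Fin n) (Fin m) ℝ :=
  P * Hᵀ * (R + H * P * Hᵀ)⁻¹

end

/-! The filter is an orthogonal decomposition, carried out on estimation errors instead of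
densities, so that a singular `P₀` needs no separate treatment. The invariant is: the prediction
error `e = x_k - predictedMean` is centred Gaussian with the deterministic covariance `predictedCov
k`, and it is independent of the past measurements.

A measurement splits `(e, w_k)` into the innovation `ν = H e + w_k` and the posterior error `ε = (1
- K H) e - K w_k`. The Kalman gain is exactly the matrix that makes these uncorrelated
(`updatedCov_mul_transpose`). They are jointly Gaussian, hence independent
(`indepFun_linear_add_linear`), and since `(e, w_k)` is independent of the past, `ε` is independent
of the past together with `ν`, that is, of all measurements through time `k`
(`posteriorError_law_and_indep`). The next prediction error is `Φ ε + u_k` with `u_k` fresh, which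
restores the invariant (`predictionError_law_and_indep`).

An error independent of the data turns into a conditional law by translation
(`condDistrib_eq_map_add_of_indepFun`), so both conditional laws are Gaussian with the recursively
defined parameters. Densities enter only through `multivariateGaussian_hasGaussianDensity`. -/

/-! ### Density of a nondegenerate Gaussian vector. -/

lemma withDensity_map_eq_map_withDensity {α β : Type*} [MeasurableSpace α] [MeasurableSpace β]
    (μ : Measure α) {f : α → β} (hf : Measurable f) {g : β → ENNReal} (hg : Measurable g) :
    (μ.map f).withDensity g = (μ.withDensity (g ∘ f)).map f := by
  ext s hs
  rw [withDensity_apply _ hs, Measure.map_apply hf hs, withDensity_apply _ (hf hs),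
    setLIntegral_map hs hg hf]
  rfl

/-- Integrability makes the factors finite measures, so that boxes determine the product, and lets
the integral over a box be computed as a Bochner integral, which factorises. -/
lemma pi_withDensity_ofReal {ι : Type*} [Fintype ι] {f : ι → ℝ → ℝ} (h0 : ∀ i x, 0 ≤ f i x)
    (hf : ∀ i, Integrable (f i)) :
    Measure.pi (fun i => volume.withDensity fun x => ENNReal.ofReal (f i x)) =
      (volume : Measure (ι → ℝ)).withDensity fun x => ENNReal.ofReal (∏ i, f i (x i)) := by
  have hfin : ∀ i, IsFiniteMeasure (volume.withDensity fun x => ENNReal.ofReal (f i x)) :=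
    fun i => isFiniteMeasure_withDensity_ofReal (hf i).2
  refine Measure.pi_eq fun s hs => ?_
  rw [withDensity_apply _ (MeasurableSet.univ_pi hs), volume_pi, Measure.restrict_pi_pi,
    ← ofReal_integral_eq_lintegral_ofReal (Integrable.fintype_prod fun i => (hf i).restrict)
      (ae_of_all _ fun x => Finset.prod_nonneg fun i _ => h0 i (x i)),
    integral_fintype_prod_eq_prod,
    ENNReal.ofReal_prod_of_nonneg fun i _ => integral_nonneg (h0 i)]
  refine Finset.prod_congr rfl fun i _ => ?_
  rw [withDensity_apply _ (hs i),
    ofReal_integral_eq_lintegral_ofReal (hf i).restrict (ae_of_all _ (h0 i))]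

lemma stdGaussian_eq_withDensity (n : ℕ) :
    stdGaussian (EuclideanSpace ℝ (Fin n)) = volume.withDensity fun v =>
      ENNReal.ofReal ((√(2 * Real.pi) ^ n)⁻¹ * Real.exp (-(1 / 2) * ‖v‖ ^ 2)) := by
  have hg : gaussianReal 0 1 =
      volume.withDensity fun x => ENNReal.ofReal (gaussianPDFReal 0 1 x) :=
    gaussianReal_of_var_ne_zero 0 one_ne_zero
  rw [← map_pi_eq_stdGaussian, hg,
    pi_withDensity_ofReal (fun _ => gaussianPDFReal_nonneg 0 1)
      (fun _ => integrable_gaussianPDFReal 0 1),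
    ← (PiLp.volume_preserving_toLp (Fin n)).map_eq,
    withDensity_map_eq_map_withDensity _ (by fun_prop) (by fun_prop)]
  congr 2
  ext x
  simp only [Function.comp_apply, gaussianPDFReal_def, Finset.prod_mul_distrib,
    ← Real.exp_sum, EuclideanSpace.real_norm_sq_eq]
  congr 2
  · simp only [NNReal.coe_one, mul_one, Finset.prod_const, Finset.card_univ, Fintype.card_fin,
      inv_pow]
  · simp only [NNReal.coe_one, Finset.mul_sum]
    congr 1
    exact Finset.sum_congr rfl fun i _ => by ring

section SquareRoot

open scoped MatrixOrder

lemma Matrix.PosSemidef.det_sqrt_eq {n : ℕ} {S : Matrix (Fin n) (Fin n) ℝ} (hS : S.PosSemidef) :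
    (CFC.sqrt S).det = √S.det := by
  simpa using hS.det_sqrt

lemma continuous_gaussianDensity {n : ℕ} (a : EuclideanSpace ℝ (Fin n))
    (S : Matrix (Fin n) (Fin n) ℝ) : Continuous (gaussianDensity a S) := by
  unfold gaussianDensity
  fun_prop

/-- The map `v ↦ a + √S v` whitens the quadratic form, because `√S S⁻¹ √S = 1`. The factor
`(√S.det)⁻¹` left over is the inverse Jacobian. -/
lemma gaussianDensity_affine {n : ℕ} (a : EuclideanSpace ℝ (Fin n))
    {S : Matrix (Fin n) (Fin n) ℝ} (hS : S.PosDef) (v : EuclideanSpace ℝ (Fin n)) :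
    gaussianDensity a S (a + toEuclideanLin (CFC.sqrt S) v) =
      (√S.det)⁻¹ * ((√(2 * Real.pi) ^ n)⁻¹ * Real.exp (-(1 / 2) * ‖v‖ ^ 2)) := by
  have hsq : CFC.sqrt S * CFC.sqrt S = S :=
    CFC.sqrt_mul_sqrt_self S hS.posSemidef.nonneg
  have hdet : IsUnit (CFC.sqrt S).det := by
    rw [hS.posSemidef.det_sqrt_eq]
    exact (Real.sqrt_pos.2 hS.det_pos).ne'.isUnit
  have hT : (CFC.sqrt S)ᵀ = CFC.sqrt S := by
    simpa using (CFC.sqrt_nonneg S).posSemidef.1.eq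
  have h : CFC.sqrt S * S⁻¹ * CFC.sqrt S = 1 := by
    rw [show S⁻¹ = (CFC.sqrt S * CFC.sqrt S)⁻¹ by rw [hsq], Matrix.mul_inv_rev,
      Matrix.mul_nonsing_inv_cancel_left _ _ hdet, Matrix.nonsing_inv_mul _ hdet]
  have hquad : (CFC.sqrt S *ᵥ v.ofLp) ⬝ᵥ (S⁻¹ *ᵥ (CFC.sqrt S *ᵥ v.ofLp)) = ‖v‖ ^ 2 := by
    rw [dotProduct_comm, dotProduct_mulVec, ← mulVec_transpose, hT, mulVec_mulVec, mulVec_mulVec,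
      h, one_mulVec, EuclideanSpace.real_norm_sq_eq]
    simp [dotProduct, sq]
  have hpow : √((2 * Real.pi) ^ n) = √(2 * Real.pi) ^ n := by
    rw [Real.sqrt_eq_iff_mul_self_eq (by positivity) (by positivity), ← mul_pow,
      Real.mul_self_sqrt (by positivity)]
  rw [gaussianDensity, det_smul, Fintype.card_fin, Real.sqrt_mul (by positivity),
    hpow, mul_inv, add_sub_cancel_left, toLpLin_apply, hquad]
  ring

/-- Change of variables: the Gaussian is the image of the standard one under `v ↦ a + √S v`, whose
Jacobian `√S.det` cancels the normalisation in `gaussianDensity_affine`. -/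
theorem multivariateGaussian_hasGaussianDensity {n : ℕ} (a : EuclideanSpace ℝ (Fin n))
    {S : Matrix (Fin n) (Fin n) ℝ} (hS : S.PosDef) :
    HasGaussianDensity (multivariateGaussian a S) a S := by
  refine ⟨hS, ?_⟩
  set A := toEuclideanLin (CFC.sqrt S) with hA
  have hpos : 0 < √S.det := Real.sqrt_pos.2 hS.det_pos
  have hdet : LinearMap.det A = √S.det := by
    rw [hA, LinearMap.det_toLpLin, hS.posSemidef.det_sqrt_eq]
  have hmap : (volume : Measure (EuclideanSpace ℝ (Fin n))).map (fun v => a + A v) =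
      ENNReal.ofReal (√S.det)⁻¹ • volume := by
    have h1 : (fun v => a + A v) = (fun v => a + v) ∘ A := rfl
    rw [h1, ← Measure.map_map (by fun_prop) (LinearMap.continuous_of_finiteDimensional A).measurable,
      Measure.map_linearMap_addHaar_eq_smul_addHaar _ (by rw [hdet]; exact hpos.ne'), hdet,
      Measure.map_smul, map_add_left_eq_self, abs_of_pos (inv_pos.2 hpos)]
  have hAm : Measurable fun v => a + A v :=
    (LinearMap.continuous_of_finiteDimensional A).measurable.const_add a
  -- Lebesgue measure is written as a multiple of its own image, so that both sides become images
  -- under the same affine map.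
  have hvol : (volume : Measure (EuclideanSpace ℝ (Fin n))) =
      ENNReal.ofReal √S.det • volume.map (fun v => a + A v) := by
    rw [hmap, smul_smul, ← ENNReal.ofReal_mul hpos.le, mul_inv_cancel₀ hpos.ne']
    simp
  have hmeas : Measurable fun v => ENNReal.ofReal (gaussianDensity a S v) :=
    (continuous_gaussianDensity a S).measurable.ennreal_ofReal
  conv_rhs => rw [hvol]
  rw [withDensity_smul_measure, withDensity_map_eq_map_withDensity _ hAm hmeas,
    ← Measure.map_smul, ← withDensity_smul _ (hmeas.comp hAm), multivariateGaussian,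
    stdGaussian_eq_withDensity]
  congr 2
  ext v
  simp only [Pi.smul_apply, Function.comp_apply, smul_eq_mul, hA, gaussianDensity_affine a hS]
  rw [← ENNReal.ofReal_mul hpos.le, mul_inv_cancel_left₀ hpos.ne']

end SquareRoot

/-! ### Independence and conditional laws. -/

section Independence

variable {Ω α β γ : Type*} [MeasurableSpace Ω] [MeasurableSpace α] [MeasurableSpace β]
  [MeasurableSpace γ] {μ : Measure Ω} [IsProbabilityMeasure μ]

/-- The joint law is `(law X ⊗ law Y) ⊗ law W`; reassociating the product moves the bracket. -/
lemma ProbabilityTheory.IndepFun.prodMk_of_indepFun_prodMk {X : Ω → α} {Y : Ω → β} {W : Ω → γ}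
    (hX : Measurable X) (hY : Measurable Y) (hW : Measurable W)
    (hXY : IndepFun X Y μ) (hXYW : IndepFun (fun ω => (X ω, Y ω)) W μ) :
    IndepFun X (fun ω => (Y ω, W ω)) μ := by
  have hYW : IndepFun Y W μ := hXYW.comp measurable_snd measurable_id
  have := Measure.isProbabilityMeasure_map hX.aemeasurable (μ := μ)
  have := Measure.isProbabilityMeasure_map hY.aemeasurable (μ := μ)
  have := Measure.isProbabilityMeasure_map hW.aemeasurable (μ := μ)
  rw [indepFun_iff_map_prod_eq_prod_map_map (by fun_prop) (by fun_prop)] at hXY hYW hXYW ⊢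
  rw [hYW, ← Measure.prodAssoc_prod, ← hXY, ← hXYW,
    Measure.map_map (by fun_prop) (by fun_prop)]
  rfl

end Independence

/-- If the residual `Y - a(X)` is independent of `X`, the conditional law of `Y` given `X` is the
law of the residual translated by `a(X)`. -/
lemma condDistrib_eq_map_add_of_indepFun {Ω β E : Type*} [MeasurableSpace Ω] [MeasurableSpace β]
    [NormedAddCommGroup E] [MeasurableSpace E] [BorelSpace E] [SecondCountableTopology E]
    [CompleteSpace E] {μ : Measure Ω} [IsProbabilityMeasure μ] {X : Ω → β} {Y : Ω → E} {a : β → E}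
    (hX : Measurable X) (hY : Measurable Y) (ha : Measurable a)
    (h : IndepFun X (fun ω => Y ω - a (X ω)) μ) :
    ∀ᵐ ω ∂μ, condDistrib Y X μ (X ω) =
      (μ.map fun ω => Y ω - a (X ω)).map fun e => a (X ω) + e := by
  have hR : Measurable fun ω => Y ω - a (X ω) := hY.sub (ha.comp hX)
  have := Measure.isProbabilityMeasure_map hR.aemeasurable (μ := μ)
  have := Measure.isProbabilityMeasure_map hX.aemeasurable (μ := μ)
  set ν := μ.map fun ω => Y ω - a (X ω) with hν
  have hadd : Measurable fun p : β × E => a p.1 + p.2 := by fun_prop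
  -- The candidate kernel sends `b` to the law of `a b` plus the residual. Once the joint law is
  -- shown to disintegrate along it, uniqueness of disintegration identifies it with `condDistrib`.
  let κ : Kernel β E := (Kernel.id ×ₖ Kernel.const β ν).map fun p : β × E => a p.1 + p.2
  have hκ : ∀ b, κ b = ν.map fun e => a b + e := by
    intro b
    rw [Kernel.map_apply _ hadd, Kernel.prod_apply, Kernel.id_apply, Kernel.const_apply,
      Measure.dirac_prod, Measure.map_map hadd (by fun_prop)]
    rfl
  have : IsMarkovKernel κ := Kernel.IsMarkovKernel.map _ hadd
  have hlaw : μ.map (fun ω => (X ω, Y ω)) = μ.map X ⊗ₘ κ := by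
    have h1 : (fun ω => (X ω, Y ω)) =
        (fun p : β × E => (p.1, a p.1 + p.2)) ∘ fun ω => (X ω, Y ω - a (X ω)) := by
      ext ω <;> simp
    rw [h1, ← Measure.map_map (by fun_prop) (hX.prodMk hR),
      (indepFun_iff_map_prod_eq_prod_map_map hX.aemeasurable hR.aemeasurable).1 h, ← hν]
    ext s hs
    rw [Measure.map_apply (by fun_prop) hs, Measure.prod_apply (by measurability),
      Measure.compProd_apply hs]
    refine lintegral_congr fun b => ?_
    rw [hκ, Measure.map_apply (by fun_prop) (measurable_prodMk_left hs)]
    rfl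
  have := ae_of_ae_map hX.aemeasurable
    (condDistrib_ae_eq_of_measure_eq_compProd X hY.aemeasurable hlaw)
  filter_upwards [this] with ω hω
  rw [hω, hκ]

/-! ### Linear combinations of Gaussian vectors. -/

lemma map_add_multivariateGaussian {n : ℕ} (a b : EuclideanSpace ℝ (Fin n))
    (S : Matrix (Fin n) (Fin n) ℝ) :
    (multivariateGaussian b S).map (fun v => a + v) = multivariateGaussian (a + b) S := by
  rw [multivariateGaussian, Measure.map_map (by fun_prop) (by fun_prop), multivariateGaussian]
  congr 1
  ext1 v
  simp [add_assoc]

lemma toEuclideanLin_transpose_inner {n m : ℕ} (A : Matrix (Fin m) (Fin n) ℝ)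
    (v : EuclideanSpace ℝ (Fin n)) (t : EuclideanSpace ℝ (Fin m)) :
    inner ℝ (toEuclideanLin A v) t = inner ℝ v (toEuclideanLin Aᵀ t) := by
  simp only [EuclideanSpace.inner_eq_star_dotProduct, toLpLin_apply, star_trivial]
  rw [dotProduct_mulVec, mulVec_transpose]

lemma dotProduct_toEuclideanLin_transpose {k l p : ℕ} (M : Matrix (Fin k) (Fin l) ℝ)
    (S : Matrix (Fin l) (Fin l) ℝ) (N : Matrix (Fin p) (Fin l) ℝ) (x : EuclideanSpace ℝ (Fin k))
    (y : EuclideanSpace ℝ (Fin p)) :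
    (toEuclideanLin Mᵀ x).ofLp ⬝ᵥ S *ᵥ (toEuclideanLin Nᵀ y).ofLp =
      x.ofLp ⬝ᵥ (M * S * Nᵀ) *ᵥ y.ofLp := by
  simp only [toLpLin_apply, ← mulVec_mulVec]
  rw [dotProduct_mulVec x.ofLp M, ← mulVec_transpose]

lemma measurable_toEuclideanLin {n m : ℕ} (A : Matrix (Fin m) (Fin n) ℝ) :
    Measurable (toEuclideanLin A) :=
  (LinearMap.continuous_of_finiteDimensional _).measurable

lemma measurable_linear_add_linear {n m p : ℕ} (A : Matrix (Fin p) (Fin n) ℝ)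
    (B : Matrix (Fin p) (Fin m) ℝ) :
    Measurable fun v : EuclideanSpace ℝ (Fin n) × EuclideanSpace ℝ (Fin m) =>
      toEuclideanLin A v.1 + toEuclideanLin B v.2 :=
  ((measurable_toEuclideanLin A).comp measurable_fst).add
    ((measurable_toEuclideanLin B).comp measurable_snd)

section GaussianPair

variable {Ω : Type*} [MeasurableSpace Ω] {μ : Measure Ω} [IsProbabilityMeasure μ] {n m p q : ℕ}
  {X : Ω → EuclideanSpace ℝ (Fin n)} {Y : Ω → EuclideanSpace ℝ (Fin m)}
  {P : Matrix (Fin n) (Fin n) ℝ} {R : Matrix (Fin m) (Fin m) ℝ}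

/-- A linear combination of independent centred Gaussian vectors is a centred Gaussian vector. -/
lemma map_linear_add_linear_eq_multivariateGaussian (hX : Measurable X) (hY : Measurable Y)
    (hP : P.PosSemidef) (hR : R.PosSemidef)
    (hXlaw : μ.map X = multivariateGaussian 0 P) (hYlaw : μ.map Y = multivariateGaussian 0 R)
    (hind : IndepFun X Y μ) (A : Matrix (Fin p) (Fin n) ℝ) (B : Matrix (Fin p) (Fin m) ℝ) :
    μ.map (fun ω => toEuclideanLin A (X ω) + toEuclideanLin B (Y ω)) =
      multivariateGaussian 0 (A * P * Aᵀ + B * R * Bᵀ) := by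
  have hA := measurable_toEuclideanLin A
  have hB := measurable_toEuclideanLin B
  have hpsd : (A * P * Aᵀ + B * R * Bᵀ).PosSemidef :=
    (by simpa using hP.mul_mul_conjTranspose_same A : (A * P * Aᵀ).PosSemidef).add
      (by simpa using hR.mul_mul_conjTranspose_same B)
  have hchar : ∀ {k l : ℕ} (C : Matrix (Fin k) (Fin l) ℝ) (ν : Measure (EuclideanSpace ℝ (Fin l)))
      (t : EuclideanSpace ℝ (Fin k)),
      charFun (ν.map (toEuclideanLin C)) t = charFun ν (toEuclideanLin Cᵀ t) := by
    intro k l C ν t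
    rw [charFun_apply, charFun_apply, integral_map (measurable_toEuclideanLin C).aemeasurable
      (by fun_prop)]
    simp_rw [toEuclideanLin_transpose_inner]
  -- Characteristic functions also cover singular covariances, where no density exists.
  refine Measure.ext_of_charFun ?_
  ext t
  change charFun (μ.map ((toEuclideanLin A ∘ X) + (toEuclideanLin B ∘ Y))) t = _
  rw [(hind.comp hA hB).charFun_map_add_eq_mul (hA.comp hX).aemeasurable
    (hB.comp hY).aemeasurable, Pi.mul_apply, ← Measure.map_map hA hX, ← Measure.map_map hB hY,
    hXlaw, hYlaw, hchar, hchar, charFun_multivariateGaussian hP, charFun_multivariateGaussian hR,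
    charFun_multivariateGaussian hpsd, dotProduct_toEuclideanLin_transpose,
    dotProduct_toEuclideanLin_transpose, ← Complex.exp_add]
  congr 1
  simp only [inner_zero_right, add_mulVec, dotProduct_add]
  push_cast
  ring

/-- Two linear combinations of independent centred Gaussian vectors with vanishing
cross-covariance are independent. -/
lemma indepFun_linear_add_linear (hX : Measurable X) (hY : Measurable Y)
    (hP : P.PosSemidef) (hR : R.PosSemidef)
    (hXlaw : μ.map X = multivariateGaussian 0 P) (hYlaw : μ.map Y = multivariateGaussian 0 R)
    (hind : IndepFun X Y μ) (A : Matrix (Fin p) (Fin n) ℝ) (B : Matrix (Fin p) (Fin m) ℝ)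
    (C : Matrix (Fin q) (Fin n) ℝ) (D : Matrix (Fin q) (Fin m) ℝ)
    (hcov : A * P * Cᵀ + B * R * Dᵀ = 0) :
    IndepFun (fun ω => toEuclideanLin A (X ω) + toEuclideanLin B (Y ω))
      (fun ω => toEuclideanLin C (X ω) + toEuclideanLin D (Y ω)) μ := by
  have hXG : HasGaussianLaw X μ := ⟨by rw [hXlaw]; infer_instance⟩
  have hYG : HasGaussianLaw Y μ := ⟨by rw [hYlaw]; infer_instance⟩
  let L : ∀ {k : ℕ}, Matrix (Fin k) (Fin n) ℝ → Matrix (Fin k) (Fin m) ℝ →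
      (EuclideanSpace ℝ (Fin n) × EuclideanSpace ℝ (Fin m) →L[ℝ] EuclideanSpace ℝ (Fin k)) :=
    fun M N => (LinearMap.toContinuousLinearMap (toEuclideanLin M)).comp (.fst ℝ _ _) +
      (LinearMap.toContinuousLinearMap (toEuclideanLin N)).comp (.snd ℝ _ _)
  -- Joint Gaussianity of the two combinations, as a linear image of an independent Gaussian pair,
  -- is what lets zero covariance imply independence.
  have hpair := (hind.hasGaussianLaw hXG hYG).map ((L A B).prod (L C D))
  refine HasGaussianLaw.indepFun_of_covariance_inner (by exact hpair) fun x y => ?_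
  have hin : ∀ {k : ℕ} (M : Matrix (Fin k) (Fin n) ℝ) (N : Matrix (Fin k) (Fin m) ℝ)
      (v : EuclideanSpace ℝ (Fin k)),
      (fun ω => inner ℝ v (toEuclideanLin M (X ω) + toEuclideanLin N (Y ω))) =
        (fun ω => inner ℝ (toEuclideanLin Mᵀ v) (X ω)) +
          fun ω => inner ℝ (toEuclideanLin Nᵀ v) (Y ω) := by
    intro k M N v
    ext ω
    simp only [Pi.add_apply, inner_add_right, toEuclideanLin_transpose_inner, transpose_transpose]
  have hX2 : ∀ v, MemLp (fun ω => inner ℝ v (X ω)) 2 μ := fun v => hXG.memLp_two.const_inner v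
  have hY2 : ∀ v, MemLp (fun ω => inner ℝ v (Y ω)) 2 μ := fun v => hYG.memLp_two.const_inner v
  have hXY : ∀ v v', cov[fun ω => inner ℝ v (X ω), fun ω => inner ℝ v' (Y ω); μ] = 0 :=
    fun v v' => (hind.comp (φ := fun e => inner ℝ v e) (ψ := fun e => inner ℝ v' e)
      (by fun_prop) (by fun_prop)).covariance_eq_zero (hX2 v) (hY2 v')
  have hcovX : ∀ {l : ℕ} {V : Ω → EuclideanSpace ℝ (Fin l)} {S : Matrix (Fin l) (Fin l) ℝ}
      (_ : Measurable V) (_ : S.PosSemidef) (_ : μ.map V = multivariateGaussian 0 S)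
      (v v' : EuclideanSpace ℝ (Fin l)),
      cov[fun ω => inner ℝ v (V ω), fun ω => inner ℝ v' (V ω); μ] =
        v.ofLp ⬝ᵥ S *ᵥ v'.ofLp := by
    intro l V S hV hS hlaw v v'
    rw [← covarianceBilin_multivariateGaussian (μ := 0) hS, covarianceBilin_apply_eq_cov
      IsGaussian.memLp_two_id, ← hlaw, covariance_map (by fun_prop) (by fun_prop)
      hV.aemeasurable]
    rfl
  rw [hin, hin, covariance_add_left (hX2 _) (hY2 _) ((hX2 _).add (hY2 _)),
    covariance_add_right (hX2 _) (hX2 _) (hY2 _), covariance_add_right (hY2 _) (hX2 _) (hY2 _),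
    hXY, covariance_comm (fun ω => inner ℝ _ (Y ω)) (fun ω => inner ℝ _ (X ω)), hXY,
    hcovX hX hP hXlaw, hcovX hY hR hYlaw]
  rw [dotProduct_toEuclideanLin_transpose, dotProduct_toEuclideanLin_transpose, add_zero, zero_add,
    ← dotProduct_add, ← add_mulVec, hcov]
  simp

end GaussianPair

/-! ### Algebra of the Kalman gain. -/

section Gain

variable {n m : ℕ} {H : Matrix (Fin m) (Fin n) ℝ} {R : Matrix (Fin m) (Fin m) ℝ}
  {P : Matrix (Fin n) (Fin n) ℝ}

/-- The covariance matrix after a measurement update, `(1 - K H) P` with `K` the Kalman gain. -/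
noncomputable def updatedCov {n m : ℕ} (H : Matrix (Fin m) (Fin n) ℝ) (R : Matrix (Fin m) (Fin m) ℝ)
    (P : Matrix (Fin n) (Fin n) ℝ) : Matrix (Fin n) (Fin n) ℝ :=
  (1 - kalmanGain H R P * H) * P

lemma posDef_innovationCov (hR : R.PosDef) (hP : P.PosSemidef) : (R + H * P * Hᵀ).PosDef :=
  hR.add_posSemidef (by simpa using hP.mul_mul_conjTranspose_same H)

lemma kalmanGain_mul_innovationCov (hR : R.PosDef) (hP : P.PosSemidef) :
    kalmanGain H R P * (R + H * P * Hᵀ) = P * Hᵀ := by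
  have hu : IsUnit (R + H * P * Hᵀ).det :=
    (posDef_innovationCov hR hP).det_pos.ne'.isUnit
  rw [kalmanGain, Matrix.nonsing_inv_mul_cancel_right _ _ hu]

/-- This rearranges `K (R + H P Hᵀ) = P Hᵀ`. It says that the posterior error `(1 - K H) e - K w` is
uncorrelated with the innovation `H e + w`. -/
lemma updatedCov_mul_transpose (hR : R.PosDef) (hP : P.PosSemidef) :
    (1 - kalmanGain H R P * H) * P * Hᵀ = kalmanGain H R P * R := by
  have h := kalmanGain_mul_innovationCov (H := H) hR hP
  rw [Matrix.mul_add] at h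
  rw [Matrix.sub_mul, Matrix.sub_mul, Matrix.one_mul, ← h]
  simp only [Matrix.mul_assoc]
  abel

/-- The left side is the covariance of `(1 - K H) e - K w`. By `updatedCov_mul_transpose`, expanding
the last transpose gives `-K R Kᵀ`, which cancels the noise term. Positivity of `updatedCov` is
visible only in this form. -/
lemma josephForm_eq_updatedCov (hR : R.PosDef) (hP : P.PosSemidef) :
    (1 - kalmanGain H R P * H) * P * (1 - kalmanGain H R P * H)ᵀ +
      -kalmanGain H R P * R * (-kalmanGain H R P)ᵀ = updatedCov H R P := by
  rw [transpose_sub, transpose_one, transpose_mul, Matrix.mul_sub, ← Matrix.mul_assoc _ Hᵀ,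
    updatedCov_mul_transpose hR hP, updatedCov, transpose_neg]
  simp

lemma posSemidef_updatedCov (hR : R.PosDef) (hP : P.PosSemidef) :
    (updatedCov H R P).PosSemidef := by
  rw [← josephForm_eq_updatedCov hR hP]
  simp only [← conjTranspose_eq_transpose_of_trivial]
  exact (hP.mul_mul_conjTranspose_same _).add (hR.posSemidef.mul_mul_conjTranspose_same _)

/-- A semidefinite matrix is definite once invertible, and `det (1 - K H) = det (1 - H K)` with `1 -
H K = R (R + H P Hᵀ)⁻¹`. -/
lemma posDef_updatedCov (hR : R.PosDef) (hP : P.PosDef) : (updatedCov H R P).PosDef := by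
  refine (posSemidef_updatedCov hR hP.posSemidef).posDef_iff_isUnit.2 ?_
  have hS := posDef_innovationCov (H := H) hR hP.posSemidef
  have hu : IsUnit (R + H * P * Hᵀ).det := hS.det_pos.ne'.isUnit
  have h : 1 - H * kalmanGain H R P = R * (R + H * P * Hᵀ)⁻¹ := by
    rw [kalmanGain, ← Matrix.mul_nonsing_inv _ hu, ← Matrix.mul_assoc, ← Matrix.mul_assoc,
      ← Matrix.sub_mul, add_sub_cancel_right]
  rw [Matrix.isUnit_iff_isUnit_det, updatedCov, det_mul, det_one_sub_mul_comm, h, det_mul]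
  exact (hR.det_pos.ne'.isUnit.mul hS.inv.det_pos.ne'.isUnit).mul hP.det_pos.ne'.isUnit

end Gain

/-! ### The deterministic recursions for means and covariances. -/

section Recursion

variable {n m : ℕ} (Φ Q : ℕ → Matrix (Fin n) (Fin n) ℝ) (H : ℕ → Matrix (Fin m) (Fin n) ℝ)
  (R : ℕ → Matrix (Fin m) (Fin m) ℝ) (xhat₀ : EuclideanSpace ℝ (Fin n))
  (P₀ : Matrix (Fin n) (Fin n) ℝ)

/-- The covariance recursion of the predictive law. -/
noncomputable def predictedCov : ℕ → Matrix (Fin n) (Fin n) ℝ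
  | 0 => P₀
  | k + 1 => Φ k * updatedCov (H k) (R k) (predictedCov k) * (Φ k)ᵀ + Q k

/-- The mean after a measurement update of the mean `a` by the measurement `ζ`. -/
noncomputable def updatedMean (H : Matrix (Fin m) (Fin n) ℝ) (R : Matrix (Fin m) (Fin m) ℝ)
    (P : Matrix (Fin n) (Fin n) ℝ) (a : EuclideanSpace ℝ (Fin n))
    (ζ : EuclideanSpace ℝ (Fin m)) : EuclideanSpace ℝ (Fin n) :=
  a + toEuclideanLin (kalmanGain H R P) (ζ - toEuclideanLin H a)

/-- The mean recursion of the predictive law, as a function of the measurements. -/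
noncomputable def predictedMean : (k : ℕ) → (Fin k → EuclideanSpace ℝ (Fin m)) →
    EuclideanSpace ℝ (Fin n)
  | 0 => fun _ => xhat₀
  | k + 1 => fun ζ => toEuclideanLin (Φ k) (updatedMean (H k) (R k) (predictedCov Φ Q H R P₀ k)
      (predictedMean k (Fin.init ζ)) (ζ (Fin.last k)))

/-- The mean of the posterior law, as a function of the measurements. -/
noncomputable def posteriorMean (k : ℕ) (ζ : Fin (k + 1) → EuclideanSpace ℝ (Fin m)) :
    EuclideanSpace ℝ (Fin n) :=
  updatedMean (H k) (R k) (predictedCov Φ Q H R P₀ k)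
    (predictedMean Φ Q H R xhat₀ P₀ k (Fin.init ζ)) (ζ (Fin.last k))

lemma measurable_finInit {α : Type*} [MeasurableSpace α] (k : ℕ) :
    Measurable (fun ζ : Fin (k + 1) → α => (Fin.init ζ : Fin k → α)) :=
  measurable_pi_lambda _ fun i => measurable_pi_apply i.castSucc

lemma measurable_updatedMean {α : Type*} [MeasurableSpace α] (H : Matrix (Fin m) (Fin n) ℝ)
    (R : Matrix (Fin m) (Fin m) ℝ) (P : Matrix (Fin n) (Fin n) ℝ)
    {f : α → EuclideanSpace ℝ (Fin n)} {g : α → EuclideanSpace ℝ (Fin m)} (hf : Measurable f)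
    (hg : Measurable g) : Measurable fun a => updatedMean H R P (f a) (g a) :=
  hf.add ((measurable_toEuclideanLin _).comp (hg.sub ((measurable_toEuclideanLin _).comp hf)))

lemma measurable_predictedMean : ∀ k, Measurable (predictedMean Φ Q H R xhat₀ P₀ k)
  | 0 => measurable_const
  | k + 1 => (measurable_toEuclideanLin _).comp (measurable_updatedMean _ _ _
      ((measurable_predictedMean k).comp (measurable_finInit k)) (measurable_pi_apply _))

lemma measurable_posteriorMean (k : ℕ) : Measurable (posteriorMean Φ Q H R xhat₀ P₀ k) :=
  measurable_updatedMean _ _ _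
    ((measurable_predictedMean Φ Q H R xhat₀ P₀ k).comp (measurable_finInit k))
    (measurable_pi_apply _)

variable {Φ Q H R P₀}

lemma posSemidef_predictedCov (hQ : ∀ k, (Q k).PosDef) (hR : ∀ k, (R k).PosDef)
    (hP₀ : P₀.PosSemidef) : ∀ k, (predictedCov Φ Q H R P₀ k).PosSemidef
  | 0 => hP₀
  | k + 1 => (by simpa using (posSemidef_updatedCov (H := H k) (hR k)
      (posSemidef_predictedCov hQ hR hP₀ k)).mul_mul_conjTranspose_same (Φ k) :
      PosSemidef _).add (hQ k).posSemidef

/-- From time `1` on, definiteness comes from the summand `Q k` alone, whatever the rank of `P₀`. -/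
lemma posDef_predictedCov (hQ : ∀ k, (Q k).PosDef) (hR : ∀ k, (R k).PosDef)
    (hP₀ : P₀.PosSemidef) : ∀ k, 1 ≤ k ∨ P₀.PosDef → (predictedCov Φ Q H R P₀ k).PosDef
  | 0, h => h.resolve_left (by simp)
  | k + 1, _ => PosDef.posSemidef_add (by simpa using (posSemidef_updatedCov (H := H k) (hR k)
      (posSemidef_predictedCov hQ hR hP₀ k)).mul_mul_conjTranspose_same (Φ k)) (hQ k)

end Recursion

/-! ### Which noise sources each variable depends on. -/

section NoiseHistory

variable {Ω : Type*} {n m : ℕ}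

/-- The `σ`-algebra generated by the noise sources in `S`. -/
@[reducible] def noiseSigma (x₀ : Ω → EuclideanSpace ℝ (Fin n)) (u : ℕ → Ω → EuclideanSpace ℝ (Fin n))
    (w : ℕ → Ω → EuclideanSpace ℝ (Fin m)) (S : Set NoiseSource) : MeasurableSpace Ω :=
  ⨆ i ∈ S, MeasurableSpace.comap (noiseFamily x₀ u w i) inferInstance

/-- The sources that influence the state at time `k`, given the measurements before time `k`. -/
def NoiseSource.before (k : ℕ) : Set NoiseSource :=
  {i | match i with
    | .init => True
    | .process j => j < k
    | .measurement j => j < k}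

variable {x₀ : Ω → EuclideanSpace ℝ (Fin n)} {u : ℕ → Ω → EuclideanSpace ℝ (Fin n)}
  {w : ℕ → Ω → EuclideanSpace ℝ (Fin m)}

lemma noiseSigma_mono {S T : Set NoiseSource} (h : S ⊆ T) :
    noiseSigma x₀ u w S ≤ noiseSigma x₀ u w T :=
  biSup_mono h

lemma measurable_noiseSigma {S : Set NoiseSource} {i : NoiseSource} (hi : i ∈ S) :
    Measurable[noiseSigma x₀ u w S] (noiseFamily x₀ u w i) :=
  Measurable.of_comap_le
    (le_biSup (fun i => MeasurableSpace.comap (noiseFamily x₀ u w i) inferInstance) hi)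

lemma NoiseSource.before_mono {j k : ℕ} (h : j ≤ k) :
    NoiseSource.before j ⊆ NoiseSource.before k := by
  rintro (_ | i | i) hi
  · trivial
  · exact lt_of_lt_of_le (show i < j from hi) h
  · exact lt_of_lt_of_le (show i < j from hi) h

end NoiseHistory

namespace IsLinearGaussianModel

variable {Ω : Type*} [MeasurableSpace Ω] {μ : Measure Ω} {n m : ℕ}
  {Φ Q : ℕ → Matrix (Fin n) (Fin n) ℝ}
  {H : ℕ → Matrix (Fin m) (Fin n) ℝ} {R : ℕ → Matrix (Fin m) (Fin m) ℝ}
  {xhat₀ : EuclideanSpace ℝ (Fin n)} {P₀ : Matrix (Fin n) (Fin n) ℝ}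
  {x u : ℕ → Ω → EuclideanSpace ℝ (Fin n)}
  {z w : ℕ → Ω → EuclideanSpace ℝ (Fin m)}

section Measurability

variable (model : IsLinearGaussianModel μ Φ Q H R xhat₀ P₀ x u z w)
include model

lemma measurable_noise : ∀ i, Measurable (noiseFamily (x 0) u w i)
  | .init => model.measurable_init
  | .process k => model.measurable_u k
  | .measurement k => model.measurable_w k

/-- Reduces the independence of fresh noise from the past to disjointness of sets of sources. -/
lemma indepFun_of_disjoint {α β : Type*} [MeasurableSpace α] [MeasurableSpace β]
    {S T : Set NoiseSource} (hST : Disjoint S T) {f : Ω → α} {g : Ω → β}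
    (hf : Measurable[noiseSigma (x 0) u w S] f) (hg : Measurable[noiseSigma (x 0) u w T] g) :
    IndepFun f g μ := by
  rw [IndepFun_iff_Indep]
  exact indep_of_indep_of_le_left (indep_of_indep_of_le_right
    (indep_iSup_of_disjoint (fun i => (model.measurable_noise i).comap_le)
      ((iIndepFun_iff_iIndep _ _ _).1 model.indep) hST) hg.comap_le) hf.comap_le

lemma noiseSigma_le (S : Set NoiseSource) : noiseSigma (x 0) u w S ≤ ‹MeasurableSpace Ω› :=
  iSup₂_le fun i _ => (model.measurable_noise i).comap_le

lemma measurable_state_noiseSigma : ∀ k,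
    Measurable[noiseSigma (x 0) u w (NoiseSource.before k)] (x k)
  | 0 => measurable_noiseSigma (i := .init) trivial
  | k + 1 => by
    rw [show x (k + 1) = fun ω => toEuclideanLin (Φ k) (x k ω) + u k ω from
      funext (model.state_eq k)]
    exact ((measurable_toEuclideanLin _).comp ((measurable_state_noiseSigma k).mono
      (noiseSigma_mono (NoiseSource.before_mono k.le_succ)) le_rfl)).add
      (measurable_noiseSigma (i := .process k) (Nat.lt_succ_self k))

lemma measurable_measurement_noiseSigma {S : Set NoiseSource} {k : ℕ}
    (hS : NoiseSource.before k ⊆ S) (hk : NoiseSource.measurement k ∈ S) :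
    Measurable[noiseSigma (x 0) u w S] (z k) := by
  rw [show z k = fun ω => toEuclideanLin (H k) (x k ω) + w k ω from
    funext (model.measurement_eq k)]
  exact ((measurable_toEuclideanLin _).comp ((model.measurable_state_noiseSigma k).mono
      (noiseSigma_mono hS) le_rfl)).add
    (measurable_noiseSigma (i := .measurement k) hk)

lemma measurable_firstMeasurements_noiseSigma {S : Set NoiseSource} {k : ℕ}
    (hS : ∀ j < k, NoiseSource.before j ⊆ S ∧ NoiseSource.measurement j ∈ S) :
    Measurable[noiseSigma (x 0) u w S] (firstMeasurements z k) :=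
  @measurable_pi_lambda _ _ _ (_) _ _ fun i =>
    model.measurable_measurement_noiseSigma (hS i i.2).1 (hS i i.2).2

lemma measurable_state (k : ℕ) : Measurable (x k) :=
  (model.measurable_state_noiseSigma k).mono (model.noiseSigma_le _) le_rfl

lemma measurable_firstMeasurements (k : ℕ) : Measurable (firstMeasurements z k) :=
  (model.measurable_firstMeasurements_noiseSigma (S := Set.univ)
    fun _ _ => ⟨Set.subset_univ _, Set.mem_univ _⟩).mono (model.noiseSigma_le _) le_rfl

lemma indepFun_measurementNoise (k : ℕ) :
    IndepFun (fun ω => (firstMeasurements z k ω, x k ω)) (w k) μ := by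
  refine model.indepFun_of_disjoint (S := NoiseSource.before k) (T := {.measurement k}) ?_
    (Measurable.prodMk (model.measurable_firstMeasurements_noiseSigma fun j hj =>
      ⟨NoiseSource.before_mono hj.le, hj⟩) (model.measurable_state_noiseSigma k))
    (measurable_noiseSigma (i := .measurement k) rfl)
  exact Set.disjoint_singleton_right.2 (lt_irrefl k)

lemma indepFun_processNoise (k : ℕ) :
    IndepFun (fun ω => (firstMeasurements z (k + 1) ω, x k ω)) (u k) μ := by
  -- `before k` stops short of `w k`, on which `z k` depends, so that source is added.
  refine model.indepFun_of_disjoint (S := insert (.measurement k) (NoiseSource.before k))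
    (T := {.process k}) ?_
    (Measurable.prodMk (model.measurable_firstMeasurements_noiseSigma fun j hj =>
      ⟨(NoiseSource.before_mono (Nat.lt_succ_iff.1 hj)).trans (Set.subset_insert _ _), ?_⟩)
      ((model.measurable_state_noiseSigma k).mono (noiseSigma_mono (Set.subset_insert _ _))
        le_rfl))
    (measurable_noiseSigma (i := .process k) rfl)
  · rw [Set.disjoint_singleton_right]
    rintro (h | h)
    · cases h
    · exact lt_irrefl k h
  · rcases (Nat.lt_succ_iff.1 hj).eq_or_lt with rfl | h
    · exact Set.mem_insert _ _
    · exact Set.mem_insert_of_mem _ h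

end Measurability

/-! ### Induction on the error laws. -/

section Filter

variable [IsProbabilityMeasure μ] (model : IsLinearGaussianModel μ Φ Q H R xhat₀ P₀ x u z w)
include model

/-- The measurement half of the induction: the old error and `w k` are recombined into two
independent parts, the new error and the innovation. -/
lemma posteriorError_law_and_indep {k : ℕ}
    (hlaw : μ.map (fun ω => x k ω - predictedMean Φ Q H R xhat₀ P₀ k (firstMeasurements z k ω)) =
      multivariateGaussian 0 (predictedCov Φ Q H R P₀ k))
    (hind : IndepFun (firstMeasurements z k)
      (fun ω => x k ω - predictedMean Φ Q H R xhat₀ P₀ k (firstMeasurements z k ω)) μ) :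
    μ.map (fun ω => x k ω -
        posteriorMean Φ Q H R xhat₀ P₀ k (firstMeasurements z (k + 1) ω)) =
      multivariateGaussian 0 (updatedCov (H k) (R k) (predictedCov Φ Q H R P₀ k)) ∧
    IndepFun (firstMeasurements z (k + 1)) (fun ω => x k ω -
        posteriorMean Φ Q H R xhat₀ P₀ k (firstMeasurements z (k + 1) ω)) μ := by
  set a := predictedMean Φ Q H R xhat₀ P₀ k with ha
  set Z := firstMeasurements z k with hZdef
  set P := predictedCov Φ Q H R P₀ k with hPdef
  set e := fun ω => x k ω - a (Z ω) with he
  set K := kalmanGain (H k) (R k) P with hK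
  have hP : P.PosSemidef :=
    posSemidef_predictedCov model.posDef_Q model.posDef_R model.posSemidef_P₀ k
  have ham : Measurable a := measurable_predictedMean Φ Q H R xhat₀ P₀ k
  have hZ : Measurable Z := model.measurable_firstMeasurements k
  have hem : Measurable e := (model.measurable_state k).sub (ham.comp hZ)
  have hw := model.measurable_w k
  have hZew : IndepFun (fun ω => (Z ω, e ω)) (w k) μ :=
    (model.indepFun_measurementNoise k).comp
      (φ := fun p => (p.1, p.2 - a p.1)) (by fun_prop) measurable_id
  have hew : IndepFun e (w k) μ := hZew.comp measurable_snd measurable_id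
  have hZ_ew := hind.prodMk_of_indepFun_prodMk hZ hem hw hZew
  set ε := fun ω => toEuclideanLin (1 - K * H k) (e ω) + toEuclideanLin (-K) (w k ω) with hε
  set ν := fun ω => toEuclideanLin (H k) (e ω) + toEuclideanLin 1 (w k ω) with hν
  have hεm : Measurable ε := ((measurable_toEuclideanLin _).comp hem).add
    ((measurable_toEuclideanLin _).comp hw)
  have hνm : Measurable ν := ((measurable_toEuclideanLin _).comp hem).add
    ((measurable_toEuclideanLin _).comp hw)
  have hεlaw : μ.map ε = multivariateGaussian 0 (updatedCov (H k) (R k) P) := by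
    rw [hε, map_linear_add_linear_eq_multivariateGaussian hem hw hP (model.posDef_R k).posSemidef
      hlaw (model.law_w k) hew, josephForm_eq_updatedCov (model.posDef_R k) hP]
  have hεν : IndepFun ε ν μ := by
    -- The required cross-covariance identity is `(1 - K H) P Hᵀ - K R = 0`, the defining property
    -- of the gain.
    refine indepFun_linear_add_linear hem hw hP (model.posDef_R k).posSemidef
      hlaw (model.law_w k) hew _ _ _ _ ?_
    rw [updatedCov_mul_transpose (model.posDef_R k) hP]
    simp [hK]
  have hενZ : IndepFun (fun ω => (ε ω, ν ω)) Z μ := by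
    exact hZ_ew.symm.comp ((measurable_linear_add_linear (1 - K * H k) (-K)).prodMk
      (measurable_linear_add_linear (H k) 1)) measurable_id
  have hε_νZ := hεν.prodMk_of_indepFun_prodMk hεm hνm hZ hενZ
  have hz : ∀ ω, z k ω = ν ω + toEuclideanLin (H k) (a (Z ω)) := by
    intro ω
    simp only [hν, he, model.measurement_eq, map_sub, toLpLin_one, LinearMap.id_apply]
    abel
  have hpost : (fun ω => x k ω -
      posteriorMean Φ Q H R xhat₀ P₀ k (firstMeasurements z (k + 1) ω)) = ε := by
    ext1 ω
    have h1 : posteriorMean Φ Q H R xhat₀ P₀ k (firstMeasurements z (k + 1) ω) =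
        a (Z ω) + toEuclideanLin K (z k ω - toEuclideanLin (H k) (a (Z ω))) := rfl
    rw [h1, hz, add_sub_cancel_right]
    simp only [hε, hν, map_sub, map_neg, map_add, toLpLin_one, LinearMap.id_apply,
      LinearMap.sub_apply, LinearMap.neg_apply, toLpLin_mul_same, LinearMap.comp_apply]
    simp only [he]
    abel
  rw [hpost]
  refine ⟨hεlaw, ?_⟩
  -- The innovation and the past determine the new measurement, so independence from `(ν, Z)` passes
  -- to `firstMeasurements z (k + 1)`.
  have hsnoc : firstMeasurements z (k + 1) = (fun p : _ × (Fin k → EuclideanSpace ℝ (Fin m)) =>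
      (Fin.snoc p.2 (p.1 + toEuclideanLin (H k) (a p.2)) :
        Fin (k + 1) → EuclideanSpace ℝ (Fin m))) ∘ fun ω => (ν ω, Z ω) := by
    ext1 ω
    ext1 i
    refine Fin.lastCases ?_ (fun i => ?_) i
    · simp [firstMeasurements, hz]
    · simp [firstMeasurements, hZdef]
  rw [hsnoc]
  refine (hε_νZ.symm).comp (measurable_pi_lambda _ fun i => ?_) measurable_id
  refine Fin.lastCases ?_ (fun i => ?_) i
  · simp only [Fin.snoc_last]
    exact measurable_fst.add ((measurable_toEuclideanLin _).comp (ham.comp measurable_snd))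
  · simp only [Fin.snoc_castSucc]
    fun_prop

/-- The time half of the induction: the new error is `Φ ε + u_k`, and `u_k` is independent of `ε`
and of all measurements through time `k`. -/
lemma predictionError_law_and_indep : ∀ k : ℕ,
    μ.map (fun ω => x k ω - predictedMean Φ Q H R xhat₀ P₀ k (firstMeasurements z k ω)) =
      multivariateGaussian 0 (predictedCov Φ Q H R P₀ k) ∧
    IndepFun (firstMeasurements z k)
      (fun ω => x k ω - predictedMean Φ Q H R xhat₀ P₀ k (firstMeasurements z k ω)) μ
  | 0 => by
    constructor
    · have h : (fun ω => x 0 ω - predictedMean Φ Q H R xhat₀ P₀ 0 (firstMeasurements z 0 ω)) =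
          (fun v => -xhat₀ + v) ∘ x 0 := by
        ext1 ω
        simp only [predictedMean, Function.comp_apply]
        abel
      rw [h, ← Measure.map_map (by fun_prop) model.measurable_init, model.law_init,
        map_add_multivariateGaussian, neg_add_cancel]
      rfl
    · have h : firstMeasurements z 0 = fun _ => Fin.elim0 := funext fun _ => Subsingleton.elim _ _
      rw [h]
      exact indepFun_const_left _ _
  | k + 1 => by
    obtain ⟨hlaw, hind⟩ := model.posteriorError_law_and_indep
      (predictionError_law_and_indep k).1 (predictionError_law_and_indep k).2
    set b := posteriorMean Φ Q H R xhat₀ P₀ k with hb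
    have hbm : Measurable b := measurable_posteriorMean Φ Q H R xhat₀ P₀ k
    have hZ : Measurable (firstMeasurements z (k + 1)) := model.measurable_firstMeasurements _
    set ε := fun ω => x k ω - b (firstMeasurements z (k + 1) ω) with hε
    have hεm : Measurable ε := (model.measurable_state k).sub (hbm.comp hZ)
    have hu := model.measurable_u k
    have hZεu : IndepFun (fun ω => (firstMeasurements z (k + 1) ω, ε ω)) (u k) μ :=
      (model.indepFun_processNoise k).comp
        (φ := fun p => (p.1, p.2 - b p.1)) (by fun_prop) measurable_id
    have hεu : IndepFun ε (u k) μ := hZεu.comp measurable_snd measurable_id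
    have hZ_εu := hind.prodMk_of_indepFun_prodMk hZ hεm hu hZεu
    have hP := posSemidef_updatedCov (H := H k) (model.posDef_R k)
      (posSemidef_predictedCov (Φ := Φ) (H := H) model.posDef_Q model.posDef_R
        model.posSemidef_P₀ k)
    have h : (fun ω => x (k + 1) ω -
        predictedMean Φ Q H R xhat₀ P₀ (k + 1) (firstMeasurements z (k + 1) ω)) =
        fun ω => toEuclideanLin (Φ k) (ε ω) + toEuclideanLin 1 (u k ω) := by
      ext1 ω
      have h1 : predictedMean Φ Q H R xhat₀ P₀ (k + 1) (firstMeasurements z (k + 1) ω) =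
        toEuclideanLin (Φ k) (b (firstMeasurements z (k + 1) ω)) := rfl
      rw [h1, model.state_eq, hε, map_sub, toLpLin_one, LinearMap.id_apply]
      abel
    rw [h]
    constructor
    · rw [map_linear_add_linear_eq_multivariateGaussian hεm hu hP (model.posDef_Q k).posSemidef
        hlaw (model.law_u k) hεu, transpose_one, Matrix.mul_one, Matrix.one_mul]
      rfl
    · exact hZ_εu.comp measurable_id (measurable_linear_add_linear (Φ k) 1)

lemma predictiveLaw_eq (k : ℕ) : ∀ᵐ ω ∂μ, predictiveLaw μ x z k ω =
    multivariateGaussian (predictedMean Φ Q H R xhat₀ P₀ k (firstMeasurements z k ω))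
      (predictedCov Φ Q H R P₀ k) := by
  obtain ⟨hlaw, hind⟩ := model.predictionError_law_and_indep k
  filter_upwards [condDistrib_eq_map_add_of_indepFun (model.measurable_firstMeasurements k)
    (model.measurable_state k) (measurable_predictedMean Φ Q H R xhat₀ P₀ k) hind] with ω hω
  rw [predictiveLaw, stateCondLaw, hω, hlaw, map_add_multivariateGaussian, add_zero]

lemma posteriorLaw_eq (k : ℕ) : ∀ᵐ ω ∂μ, posteriorLaw μ x z k ω =
    multivariateGaussian (posteriorMean Φ Q H R xhat₀ P₀ k (firstMeasurements z (k + 1) ω))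
      (updatedCov (H k) (R k) (predictedCov Φ Q H R P₀ k)) := by
  obtain ⟨hlaw, hind⟩ := model.posteriorError_law_and_indep
    (model.predictionError_law_and_indep k).1 (model.predictionError_law_and_indep k).2
  filter_upwards [condDistrib_eq_map_add_of_indepFun (model.measurable_firstMeasurements (k + 1))
    (model.measurable_state k) (measurable_posteriorMean Φ Q H R xhat₀ P₀ k) hind] with ω hω
  rw [posteriorLaw, stateCondLaw, hω, hlaw, map_add_multivariateGaussian, add_zero]

end Filter

end IsLinearGaussianModel

/-! ### Reading off the filter equations. -/

lemma meanVec_multivariateGaussian {n : ℕ} (a : EuclideanSpace ℝ (Fin n))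
    (S : Matrix (Fin n) (Fin n) ℝ) : meanVec (multivariateGaussian a S) = a :=
  integral_id_multivariateGaussian

lemma covMat_multivariateGaussian {n : ℕ} (a : EuclideanSpace ℝ (Fin n))
    {S : Matrix (Fin n) (Fin n) ℝ} (hS : S.PosSemidef) :
    covMat (multivariateGaussian a S) = S := by
  ext i j
  exact covariance_eval_multivariateGaussian hS i j

theorem mainTheorem8 {Ω : Type*} [MeasurableSpace Ω] (μ : Measure Ω) [IsProbabilityMeasure μ]
    {n m : ℕ}
    (Φ Q : ℕ → Matrix (Fin n) (Fin n) ℝ)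
    (H : ℕ → Matrix (Fin m) (Fin n) ℝ) (R : ℕ → Matrix (Fin m) (Fin m) ℝ)
    (xhat₀ : EuclideanSpace ℝ (Fin n)) (P₀ : Matrix (Fin n) (Fin n) ℝ)
    (x u : ℕ → Ω → EuclideanSpace ℝ (Fin n))
    (z w : ℕ → Ω → EuclideanSpace ℝ (Fin m))
    (model : IsLinearGaussianModel μ Φ Q H R xhat₀ P₀ x u z w) :
    ∀ᵐ ω ∂μ,
      -- notation: mean and covariance of the predictive and posterior laws, and the gain
      let xPred : ℕ → EuclideanSpace ℝ (Fin n) := fun k => meanVec (predictiveLaw μ x z k ω)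
      let PPred : ℕ → Matrix (Fin n) (Fin n) ℝ := fun k => covMat (predictiveLaw μ x z k ω)
      let xPost : ℕ → EuclideanSpace ℝ (Fin n) := fun k => meanVec (posteriorLaw μ x z k ω)
      let PPost : ℕ → Matrix (Fin n) (Fin n) ℝ := fun k => covMat (posteriorLaw μ x z k ω)
      let K : ℕ → Matrix (Fin n) (Fin m) ℝ := fun k => kalmanGain (H k) (R k) (PPred k)
      -- initial values
      xPred 0 = xhat₀ ∧ PPred 0 = P₀ ∧
      ∀ k : ℕ,
        -- both conditional laws are Gaussian
        predictiveLaw μ x z k ω = multivariateGaussian (xPred k) (PPred k) ∧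
        posteriorLaw μ x z k ω = multivariateGaussian (xPost k) (PPost k) ∧
        -- and have Gaussian densities, except possibly at time `0` when `P₀` is singular
        (1 ≤ k ∨ P₀.PosDef →
          HasGaussianDensity (predictiveLaw μ x z k ω) (xPred k) (PPred k) ∧
          HasGaussianDensity (posteriorLaw μ x z k ω) (xPost k) (PPost k)) ∧
        -- predictor
        xPred (k + 1) = toEuclideanLin (Φ k) (xPost k) ∧
        PPred (k + 1) = Φ k * PPost k * (Φ k)ᵀ + Q k ∧
        -- update
        xPost k = xPred k + toEuclideanLin (K k) (z k ω - toEuclideanLin (H k) (xPred k)) ∧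
        PPost k = (1 - K k * H k) * PPred k ∧
        -- one-step form, obtained by putting the update into the predictor
        xPred (k + 1) = toEuclideanLin (Φ k) (xPred k) +
          toEuclideanLin (Φ k * PPred k * (H k)ᵀ * (H k * PPred k * (H k)ᵀ + R k)⁻¹)
            (z k ω - toEuclideanLin (H k) (xPred k)) ∧
        PPred (k + 1) = Φ k * (PPred k *
          (1 - (H k)ᵀ * (H k * PPred k * (H k)ᵀ + R k)⁻¹ * H k * PPred k)) * (Φ k)ᵀ + Q k := by
  -- Countably many times, hence a single null set outside which both formulas hold for every `k`.
  filter_upwards [ae_all_iff.2 model.predictiveLaw_eq, ae_all_iff.2 model.posteriorLaw_eq]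
    with ω hpred hpost
  have hP := posSemidef_predictedCov (Φ := Φ) (H := H) model.posDef_Q model.posDef_R
    model.posSemidef_P₀
  have hU : ∀ k, (updatedCov (H k) (R k) (predictedCov Φ Q H R P₀ k)).PosSemidef :=
    fun k => posSemidef_updatedCov (model.posDef_R k) (hP k)
  simp only [hpred, hpost, meanVec_multivariateGaussian, covMat_multivariateGaussian _ (hP _),
    covMat_multivariateGaussian _ (hU _)]
  -- The predictor and update equations are the defining equations of the recursions, hence the
  -- `rfl`s. Only the densities and the one-step forms remain, the latter requiring rearranged
  -- products and the innovation covariance with its summands swapped.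
  refine ⟨rfl, rfl, fun k => ⟨trivial, trivial, fun hk => ?_, rfl, rfl, rfl, rfl, ?_, ?_⟩⟩
  · have hpd := posDef_predictedCov (Φ := Φ) (H := H) model.posDef_Q model.posDef_R
      model.posSemidef_P₀ k hk
    exact ⟨multivariateGaussian_hasGaussianDensity _ hpd,
      multivariateGaussian_hasGaussianDensity _ (posDef_updatedCov (model.posDef_R k) hpd)⟩
  · change toEuclideanLin (Φ k) (_ + toEuclideanLin (kalmanGain _ _ _) _) = _
    rw [map_add, kalmanGain, ← LinearMap.comp_apply, ← toLpLin_mul_same,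
      add_comm (R k)]
    simp only [Matrix.mul_assoc]
    rfl
  · change Φ k * ((1 - kalmanGain _ _ _ * H k) * _) * (Φ k)ᵀ + Q k = _
    rw [kalmanGain, add_comm (R k), Matrix.sub_mul, Matrix.mul_sub (predictedCov Φ Q H R P₀ k)]
    simp only [Matrix.mul_assoc, Matrix.one_mul, Matrix.mul_one]
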